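/- Let $\mathbb K$ be a field. A finite simplicial complex $\Gamma$ with finite vertex set $V=V(\Gamma)$ is a collection of subsets of $V$ (its faces) that is closed under taking subsets and contains $\varnothing$ and every singleton $\{v\}$, $v\in V$. For $T\subseteq V$, let $\Gamma_T=\{X\cap T : X\in\Gamma\}$ be the induced complex on $T$, and let $\uplus$ denote disjoint union of complexes. Let $\mathcal A$ be the $\mathbb K$-vector space with basis the isomorphism classes of finite simplicial complexes (a complex also denotes its class), with product $\Gamma\cdot\Theta=\Gamma\uplus\Theta$, unit the complex $\varnothing$ with no vertices, coproduct $\Delta(\Gamma)=\sum_{T\subseteq V(\Gamma)}\Gamma_T\otimes\Gamma_{V(\Gamma)\setminus T}$, and counit $\epsilon(\Gamma)=1$ if $V(\Gamma)=\varnothing$ and $\epsilon(\Gamma)=0$ otherwise. Then $\mathcal A$ is a Hopf algebra; let $S$ be its antipode. For a finite simple graph $G=(V,E)$, a flat of $G$ is a set $F\subseteq E$ such that each connected component of the graph $(V,F)$ is an induced subgraph of $G$; $\mathcal F(G)$ is the set of flats, $c(F)$ is the number of connected components of $(V,F)$, $G/F$ is the graph obtained from $G$ by contracting the edges in $F$ (parallel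 edges being identified), and $a(G)$ is the number of acyclic orientations of $G$. The 1-skeleton $\Gamma^{(1)}$ of a complex $\Gamma$ is regarded as a simple graph on $V(\Gamma)$, and for a flat $F$ of $\Gamma^{(1)}$, $\Gamma_{V,F}$ is the subcomplex of $\Gamma$, with the same vertex set $V=V(\Gamma)$, consisting of the faces of $\Gamma$ all of whose edges belong to $F$. **Theorem.** Let $\Gamma$ be a simplicial complex on $n\ge 1$ vertices. Then, in $\mathcal A$, $$S(\Gamma)=\sum_{F\in\mathcal F(\Gamma^{(1)})}(-1)^{c(F)}\,a(\Gamma^{(1)}/F)\,\Gamma_{V,F}.$$ Moreover, this formula is cancellation-free: each integer $(-1)^{c(F)}a(\Gamma^{(1)}/F)$ is nonzero, and if $F,F'$ are flats of $\Gamma^{(1)}$ with $\Gamma_{V,F}\cong\Gamma_{V,F'}$, then the integers $(-1)^{c(F)}a(\Gamma^{(1)}/F)$ and $(-1)^{c(F')}a(\Gamma^{(1)}/F')$ have the same sign. -/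

import Mathlib

universe u v

noncomputable section

open scoped TensorProduct

namespace AbstractSimplicialComplex

variable {V W X V' W' : Type u}

/-- The pull-back of a complex along an injection of vertex sets: a nonempty set is a face iff its
image is a face. -/
def comap (K : AbstractSimplicialComplex V) (f : W ↪ V) : AbstractSimplicialComplex W where
  faces := {s | s.map f ∈ K.faces}
  isRelLowerSet_faces := by
    intro s hs
    have h := K.isRelLowerSet_faces hs
    refine ⟨by simpa using h.1, fun t hts ht => h.2 (Finset.map_subset_map.2 hts) ?_⟩
    simpa using ht
  singleton_mem v := by simpa using K.singleton_mem (f v)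

/-- The induced complex `Γ_T` on a set `T` of vertices. Its faces are the faces of `Γ` contained
in `T`. -/
def induce (K : AbstractSimplicialComplex V) (T : Set V) : AbstractSimplicialComplex T :=
  K.comap (Function.Embedding.subtype (· ∈ T))

/-- The disjoint union `Γ ⊎ Θ`, on the disjoint union of the vertex sets. -/
def disjUnion (K : AbstractSimplicialComplex V) (L : AbstractSimplicialComplex W) :
    AbstractSimplicialComplex (V ⊕ W) where
  faces := {s | (∃ t ∈ K.faces, s = t.map Function.Embedding.inl) ∨
    ∃ t ∈ L.faces, s = t.map Function.Embedding.inr}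
  isRelLowerSet_faces := by
    rintro _ (⟨t, ht, rfl⟩ | ⟨t, ht, rfl⟩)
    · have h := K.isRelLowerSet_faces ht
      refine ⟨by simpa using h.1, fun r hr hr' => Or.inl ?_⟩
      obtain ⟨q, hq, rfl⟩ := Finset.subset_map_iff.1 hr
      exact ⟨q, h.2 hq (by simpa using hr'), rfl⟩
    · have h := L.isRelLowerSet_faces ht
      refine ⟨by simpa using h.1, fun r hr hr' => Or.inr ?_⟩
      obtain ⟨q, hq, rfl⟩ := Finset.subset_map_iff.1 hr
      exact ⟨q, h.2 hq (by simpa using hr'), rfl⟩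
  singleton_mem v := by
    rcases v with v | w
    · exact Or.inl ⟨{v}, K.singleton_mem v, by simp⟩
    · exact Or.inr ⟨{w}, L.singleton_mem w, by simp⟩

open Classical in
/-- The `1`-skeleton of a complex, as a simple graph. -/
def oneSkeleton (K : AbstractSimplicialComplex V) : SimpleGraph V where
  Adj v w := v ≠ w ∧ ({v, w} : Finset V) ∈ K.faces
  symm.symm v w h := ⟨h.1.symm, by rw [Finset.pair_comm]; exact h.2⟩
  loopless.irrefl v h := h.1 rfl

/-- The complex `Γ_{V,F}` for a set `F` of edges: the faces of `Γ` all of whose edges are in `F`. -/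
def restrictEdges (K : AbstractSimplicialComplex V) (F : Set (Sym2 V)) :
    AbstractSimplicialComplex V where
  faces := {s | s ∈ K.faces ∧ ∀ v ∈ s, ∀ w ∈ s, v ≠ w → s(v, w) ∈ F}
  isRelLowerSet_faces := by
    rintro s ⟨hs, hF⟩
    have h := K.isRelLowerSet_faces hs
    exact ⟨h.1, fun t hts ht => ⟨h.2 hts ht,
      fun v hv w hw => hF v (hts hv) w (hts hw)⟩⟩
  singleton_mem v := ⟨K.singleton_mem v, by
    intro a ha b hb hab
    rw [Finset.mem_singleton] at ha hb
    exact absurd (ha.trans hb.symm) hab⟩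

/-- Two complexes are isomorphic if a bijection of their vertex sets matches up their faces. -/
def Isomorphic (K : AbstractSimplicialComplex V) (L : AbstractSimplicialComplex W) : Prop :=
  ∃ e : V ≃ W, ∀ s : Finset V, s.map e.toEmbedding ∈ L.faces ↔ s ∈ K.faces

theorem Isomorphic.refl (K : AbstractSimplicialComplex V) : K.Isomorphic K :=
  ⟨Equiv.refl V, fun s => by simp⟩

theorem Isomorphic.symm {K : AbstractSimplicialComplex V} {L : AbstractSimplicialComplex W}
    (h : K.Isomorphic L) : L.Isomorphic K := by
  obtain ⟨e, he⟩ := h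
  exact ⟨e.symm, fun s => by rw [← he, Finset.map_map]; simp⟩

theorem Isomorphic.trans {K : AbstractSimplicialComplex V} {L : AbstractSimplicialComplex W}
    {M : AbstractSimplicialComplex X} (h : K.Isomorphic L) (h' : L.Isomorphic M) :
    K.Isomorphic M := by
  obtain ⟨e, he⟩ := h
  obtain ⟨e', he'⟩ := h'
  refine ⟨e.trans e', fun s => ?_⟩
  rw [← he, ← he', Finset.map_map]
  rfl

theorem mem_comap {K : AbstractSimplicialComplex V} {f : W ↪ V} {s : Finset W} :
    s ∈ (K.comap f).faces ↔ s.map f ∈ K.faces := Iff.rfl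


theorem mem_disjUnion {K : AbstractSimplicialComplex V} {L : AbstractSimplicialComplex W}
    {s : Finset (V ⊕ W)} : s ∈ (K.disjUnion L).faces ↔
      (∃ t ∈ K.faces, s = t.map Function.Embedding.inl) ∨
      ∃ t ∈ L.faces, s = t.map Function.Embedding.inr := Iff.rfl

theorem map_inl_mem_disjUnion {K : AbstractSimplicialComplex V} {L : AbstractSimplicialComplex W}
    {s : Finset V} : s.map Function.Embedding.inl ∈ (K.disjUnion L).faces ↔ s ∈ K.faces := by
  refine ⟨?_, fun h => Or.inl ⟨s, h, rfl⟩⟩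
  rintro (⟨t, ht, h⟩ | ⟨t, ht, h⟩)
  · rwa [Finset.map_injective _ h]
  · obtain ⟨x, hx⟩ := (L.isRelLowerSet_faces ht).1
    have hm : Function.Embedding.inr x ∈ t.map (Function.Embedding.inr : W ↪ V ⊕ W) :=
      Finset.mem_map_of_mem _ hx
    rw [← h] at hm
    simp at hm

theorem map_inr_mem_disjUnion {K : AbstractSimplicialComplex V} {L : AbstractSimplicialComplex W}
    {s : Finset W} : s.map Function.Embedding.inr ∈ (K.disjUnion L).faces ↔ s ∈ L.faces := by
  refine ⟨?_, fun h => Or.inr ⟨s, h, rfl⟩⟩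
  rintro (⟨t, ht, h⟩ | ⟨t, ht, h⟩)
  · obtain ⟨x, hx⟩ := (K.isRelLowerSet_faces ht).1
    have hm : Function.Embedding.inl x ∈ t.map (Function.Embedding.inl : V ↪ V ⊕ W) :=
      Finset.mem_map_of_mem _ hx
    rw [← h] at hm
    simp at hm
  · rwa [Finset.map_injective _ h]

/-- A criterion for a complex to be isomorphic to a disjoint union. -/
theorem isomorphic_disjUnion {K : AbstractSimplicialComplex V} {L : AbstractSimplicialComplex W}
    {M : AbstractSimplicialComplex X} (e : V ⊕ W ≃ X)
    (h1 : ∀ s : Finset V,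
      s.map (Function.Embedding.inl.trans e.toEmbedding) ∈ M.faces ↔ s ∈ K.faces)
    (h2 : ∀ s : Finset W,
      s.map (Function.Embedding.inr.trans e.toEmbedding) ∈ M.faces ↔ s ∈ L.faces)
    (h3 : ∀ t ∈ M.faces, (∃ s : Finset V, t = s.map (Function.Embedding.inl.trans e.toEmbedding)) ∨
      ∃ s : Finset W, t = s.map (Function.Embedding.inr.trans e.toEmbedding)) :
    (K.disjUnion L).Isomorphic M := by
  refine ⟨e, fun s => ⟨fun h => ?_, ?_⟩⟩
  · rcases h3 _ h with ⟨t, ht⟩ | ⟨t, ht⟩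
    · have hs : s = t.map Function.Embedding.inl := by
        apply Finset.map_injective e.toEmbedding
        rw [ht, Finset.map_map]
      rw [ht, h1] at h
      exact Or.inl ⟨t, h, hs⟩
    · have hs : s = t.map Function.Embedding.inr := by
        apply Finset.map_injective e.toEmbedding
        rw [ht, Finset.map_map]
      rw [ht, h2] at h
      exact Or.inr ⟨t, h, hs⟩
  · rintro (⟨t, ht, rfl⟩ | ⟨t, ht, rfl⟩)
    · rw [Finset.map_map]; exact (h1 t).2 ht
    · rw [Finset.map_map]; exact (h2 t).2 ht

theorem Isomorphic.disjUnion {K : AbstractSimplicialComplex V} {L : AbstractSimplicialComplex W}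
    {K' : AbstractSimplicialComplex V'} {L' : AbstractSimplicialComplex W'}
    (h : K.Isomorphic K') (h' : L.Isomorphic L') :
    (K.disjUnion L).Isomorphic (K'.disjUnion L') := by
  obtain ⟨e, he⟩ := h
  obtain ⟨f, hf⟩ := h'
  have hl : (Function.Embedding.inl.trans (Equiv.sumCongr e f).toEmbedding) =
    e.toEmbedding.trans Function.Embedding.inl := by ext; rfl
  have hr : (Function.Embedding.inr.trans (Equiv.sumCongr e f).toEmbedding) =
    f.toEmbedding.trans Function.Embedding.inr := by ext; rfl
  refine isomorphic_disjUnion (Equiv.sumCongr e f) (fun s => ?_) (fun s => ?_) ?_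
  · rw [hl, ← Finset.map_map, map_inl_mem_disjUnion, he]
  · rw [hr, ← Finset.map_map, map_inr_mem_disjUnion, hf]
  · rw [hl, hr]
    rintro _ (⟨t, ht, rfl⟩ | ⟨t, ht, rfl⟩)
    · exact Or.inl ⟨t.map e.symm.toEmbedding, by
        rw [Finset.map_map, ← Function.Embedding.trans_assoc]; simp⟩
    · exact Or.inr ⟨t.map f.symm.toEmbedding, by
        rw [Finset.map_map, ← Function.Embedding.trans_assoc]; simp⟩

theorem disjUnion_comm (K : AbstractSimplicialComplex V) (L : AbstractSimplicialComplex W) :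
    (K.disjUnion L).Isomorphic (L.disjUnion K) := by
  refine isomorphic_disjUnion (Equiv.sumComm V W) (fun s => ?_) (fun s => ?_) ?_
  · exact map_inr_mem_disjUnion
  · exact map_inl_mem_disjUnion
  · rintro _ (⟨t, ht, rfl⟩ | ⟨t, ht, rfl⟩)
    · exact Or.inr ⟨t, rfl⟩
    · exact Or.inl ⟨t, rfl⟩

theorem disjUnion_empty [IsEmpty W] (K : AbstractSimplicialComplex V)
    (L : AbstractSimplicialComplex W) : (K.disjUnion L).Isomorphic K := by
  have hl : (Function.Embedding.inl.trans (Equiv.sumEmpty V W).toEmbedding) =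
    Function.Embedding.refl V := by ext; rfl
  refine isomorphic_disjUnion (Equiv.sumEmpty V W) (fun s => ?_) (fun s => ?_) ?_
  · rw [hl, Finset.map_refl]
  · have hs : s = ∅ := Finset.eq_empty_of_isEmpty s
    subst hs
    constructor
    · intro h
      exact absurd (K.isRelLowerSet_faces h).1 (by simp)
    · intro h
      exact absurd (L.isRelLowerSet_faces h).1 (by simp)
  · intro t _
    exact Or.inl ⟨t, by rw [hl, Finset.map_refl]⟩

theorem disjUnion_assoc (K : AbstractSimplicialComplex V) (L : AbstractSimplicialComplex W)
    (M : AbstractSimplicialComplex X) :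
    ((K.disjUnion L).disjUnion M).Isomorphic (K.disjUnion (L.disjUnion M)) := by
  have hll : Function.Embedding.inl.trans (Function.Embedding.inl.trans
      (Equiv.sumAssoc V W X).toEmbedding) = Function.Embedding.inl := by ext; rfl
  have hlr : Function.Embedding.inr.trans (Function.Embedding.inl.trans
      (Equiv.sumAssoc V W X).toEmbedding) =
        Function.Embedding.inl.trans Function.Embedding.inr := by ext; rfl
  have hr : Function.Embedding.inr.trans (Equiv.sumAssoc V W X).toEmbedding =
        Function.Embedding.inr.trans Function.Embedding.inr := by ext; rfl
  refine isomorphic_disjUnion (Equiv.sumAssoc V W X) (fun s => ⟨fun h => ?_, ?_⟩) (fun s => ?_) ?_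
  · rcases h with ⟨t, ht, h⟩ | ⟨t, ht, h⟩
    · refine Or.inl ⟨t, ht, ?_⟩
      apply Finset.map_injective (Function.Embedding.inl.trans (Equiv.sumAssoc V W X).toEmbedding)
      rw [h, Finset.map_map, hll]
    · rcases ht with ⟨t, ht, rfl⟩ | ⟨t, ht, rfl⟩
      · refine Or.inr ⟨t, ht, ?_⟩
        apply Finset.map_injective
          (Function.Embedding.inl.trans (Equiv.sumAssoc V W X).toEmbedding)
        rw [h, Finset.map_map, Finset.map_map, hlr]
      · obtain ⟨x, hx⟩ := (M.isRelLowerSet_faces ht).1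
        have hm : Sum.inr (Sum.inr x) ∈ (t.map Function.Embedding.inr).map
            (Function.Embedding.inr : W ⊕ X ↪ V ⊕ (W ⊕ X)) :=
          Finset.mem_map_of_mem _ (Finset.mem_map_of_mem _ hx)
        rw [← h] at hm
        simp at hm
  · rintro (⟨t, ht, rfl⟩ | ⟨t, ht, rfl⟩)
    · rw [Finset.map_map, hll]
      exact map_inl_mem_disjUnion.2 ht
    · rw [Finset.map_map, hlr, ← Finset.map_map]
      exact map_inr_mem_disjUnion.2 (map_inl_mem_disjUnion.2 ht)
  · rw [hr, ← Finset.map_map, map_inr_mem_disjUnion, map_inr_mem_disjUnion]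
  · rintro _ (⟨t, ht, rfl⟩ | ⟨t, ht, rfl⟩)
    · exact Or.inl ⟨t.map Function.Embedding.inl, by rw [Finset.map_map, hll]⟩
    · rcases ht with ⟨t, ht, rfl⟩ | ⟨t, ht, rfl⟩
      · exact Or.inl ⟨t.map Function.Embedding.inr, by
          rw [Finset.map_map, Finset.map_map, hlr]⟩
      · exact Or.inr ⟨t, by rw [Finset.map_map, hr]⟩

theorem induce_disjUnion (K : AbstractSimplicialComplex V) (L : AbstractSimplicialComplex W)
    (T : Set V) (U : Set W) :
    ((K.induce T).disjUnion (L.induce U)).Isomorphic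
      ((K.disjUnion L).induce (Sum.inl '' T ∪ Sum.inr '' U)) := by
  let e : T ⊕ U ≃ (Sum.inl '' T ∪ Sum.inr '' U : Set (V ⊕ W)) :=
    Equiv.ofBijective (fun x => match x with
      | Sum.inl t => ⟨Sum.inl t.1, Or.inl ⟨t.1, t.2, rfl⟩⟩
      | Sum.inr t => ⟨Sum.inr t.1, Or.inr ⟨t.1, t.2, rfl⟩⟩) (by
      constructor
      · rintro (⟨a, ha⟩ | ⟨a, ha⟩) (⟨b, hb⟩ | ⟨b, hb⟩) h <;>
          simpa using congrArg Subtype.val h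
      · rintro ⟨_, ⟨a, ha, rfl⟩ | ⟨a, ha, rfl⟩⟩
        · exact ⟨Sum.inl ⟨a, ha⟩, rfl⟩
        · exact ⟨Sum.inr ⟨a, ha⟩, rfl⟩)
  have hl : (Function.Embedding.inl.trans e.toEmbedding).trans
      (Function.Embedding.subtype (· ∈ (Sum.inl '' T ∪ Sum.inr '' U : Set (V ⊕ W)))) =
      (Function.Embedding.subtype (· ∈ T)).trans Function.Embedding.inl := by
    ext; rfl
  have hr : (Function.Embedding.inr.trans e.toEmbedding).trans
      (Function.Embedding.subtype (· ∈ (Sum.inl '' T ∪ Sum.inr '' U : Set (V ⊕ W)))) =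
      (Function.Embedding.subtype (· ∈ U)).trans Function.Embedding.inr := by
    ext; rfl
  refine isomorphic_disjUnion e (fun s => ?_) (fun s => ?_) ?_
  · rw [induce, induce, mem_comap, mem_comap, Finset.map_map, hl, ← Finset.map_map,
      map_inl_mem_disjUnion]
  · rw [induce, induce, mem_comap, mem_comap, Finset.map_map, hr, ← Finset.map_map,
      map_inr_mem_disjUnion]
  · intro t ht
    rw [induce, mem_comap] at ht
    classical
    rcases ht with ⟨r, hr', h⟩ | ⟨r, hr', h⟩
    · refine Or.inl ⟨r.subtype (· ∈ T), ?_⟩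
      apply Finset.map_injective (Function.Embedding.subtype _)
      rw [Finset.map_map, hl, ← Finset.map_map, h, Finset.subtype_map_of_mem]
      intro x hx
      have : Sum.inl x ∈ r.map (Function.Embedding.inl : V ↪ V ⊕ W) := Finset.mem_map_of_mem _ hx
      rw [← h] at this
      simp only [Finset.mem_map, Function.Embedding.subtype_apply] at this
      obtain ⟨⟨y, hy⟩, -, h'⟩ := this
      simp only at h'
      subst h'
      simpa using hy
    · refine Or.inr ⟨r.subtype (· ∈ U), ?_⟩
      apply Finset.map_injective (Function.Embedding.subtype _)
      rw [Finset.map_map, hr, ← Finset.map_map, h, Finset.subtype_map_of_mem]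
      intro x hx
      have : Sum.inr x ∈ r.map (Function.Embedding.inr : W ↪ V ⊕ W) := Finset.mem_map_of_mem _ hx
      rw [← h] at this
      simp only [Finset.mem_map, Function.Embedding.subtype_apply] at this
      obtain ⟨⟨y, hy⟩, -, h'⟩ := this
      simp only at h'
      subst h'
      simpa using hy

end AbstractSimplicialComplex

/-- A finite simplicial complex together with its vertex set. -/
structure FinComplex where
  /-- the vertex set -/
  V : Type u
  [fintype : Fintype V]
  /-- the complex -/
  complex : AbstractSimplicialComplex V

attribute [instance] FinComplex.fintype

instance FinComplex.setoid : Setoid FinComplex.{u} where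
  r Γ Θ := Γ.complex.Isomorphic Θ.complex
  iseqv := ⟨fun _ => .refl _, fun h => h.symm, fun h h' => h.trans h'⟩

/-- Isomorphism classes of finite simplicial complexes. -/
def ComplexClass : Type (u + 1) := Quotient FinComplex.setoid.{u}

namespace AbstractSimplicialComplex

variable {V W : Type u} [Finite V] [Finite W]

/-- The isomorphism class `[Γ]` of a finite complex `Γ`. -/
def cls (K : AbstractSimplicialComplex V) : ComplexClass.{u} :=
  letI := Fintype.ofFinite V
  Quotient.mk _ ⟨V, K⟩

theorem cls_eq_iff {K : AbstractSimplicialComplex V} {L : AbstractSimplicialComplex W} :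
    K.cls = L.cls ↔ K.Isomorphic L := Quotient.eq

theorem cls_complex (Γ : FinComplex.{u}) : Γ.complex.cls = Quotient.mk _ Γ :=
  Quotient.sound (.refl _)

theorem cls_ind {p : ComplexClass.{u} → Prop}
    (h : ∀ (V : Type u) [Fintype V] (K : AbstractSimplicialComplex V), p K.cls)
    (x : ComplexClass.{u}) : p x := by
  induction x using Quotient.inductionOn with
  | h Γ => rw [← cls_complex]; exact h _ _

theorem cls_comap {X : Type u} (K : AbstractSimplicialComplex X) (f : W ↪ X) :
    (K.comap f).cls = (K.induce (Set.range f)).cls := by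
  refine cls_eq_iff.2 ⟨Equiv.ofInjective f f.injective, fun s => ?_⟩
  rw [induce, mem_comap, mem_comap, Finset.map_map]
  rfl

theorem cls_induce_congr (K : AbstractSimplicialComplex V) {T U : Set V} (h : T = U) :
    (K.induce T).cls = (K.induce U).cls := by
  subst h
  rfl

theorem cls_induce_induce (K : AbstractSimplicialComplex V) (T : Set V) (U : Set T) :
    ((K.induce T).induce U).cls = (K.induce (Subtype.val '' U)).cls := by
  have h := cls_comap K ((Function.Embedding.subtype (· ∈ U)).trans
    (Function.Embedding.subtype (· ∈ T)))
  have h2 : (K.induce T).induce U = K.comap ((Function.Embedding.subtype (· ∈ U)).trans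
    (Function.Embedding.subtype (· ∈ T))) := by
    ext s
    rw [induce, induce, mem_comap, mem_comap, mem_comap, Finset.map_map]
  have h3 : Set.range ((Function.Embedding.subtype (· ∈ U)).trans
    (Function.Embedding.subtype (· ∈ T))) = Subtype.val '' U := by
    ext x
    simp
  rw [h2, h]
  exact cls_induce_congr K h3

theorem cls_induce_univ (K : AbstractSimplicialComplex V) : (K.induce Set.univ).cls = K.cls :=
  cls_eq_iff.2 ⟨Equiv.Set.univ V, fun _ => Iff.rfl⟩

theorem cls_of_isEmpty [IsEmpty V] [IsEmpty W] (K : AbstractSimplicialComplex V)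
    (L : AbstractSimplicialComplex W) : K.cls = L.cls := by
  refine cls_eq_iff.2 ⟨Equiv.equivOfIsEmpty V W, fun s => ?_⟩
  have hs : s = ∅ := Finset.eq_empty_of_isEmpty s
  subst hs
  constructor
  · intro h
    exact absurd (L.isRelLowerSet_faces h).1 (by simp)
  · intro h
    exact absurd (K.isRelLowerSet_faces h).1 (by simp)

end AbstractSimplicialComplex

open AbstractSimplicialComplex

/-- Isomorphism classes form a commutative monoid under disjoint union; the unit is the class of
the complex without vertices. -/
instance ComplexClass.commMonoid : CommMonoid ComplexClass.{u} where
  mul := Quotient.map₂ (fun Γ Θ => ⟨Γ.V ⊕ Θ.V, Γ.complex.disjUnion Θ.complex⟩)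
    (fun _ _ h _ _ h' => Isomorphic.disjUnion h h')
  one := (⊥ : AbstractSimplicialComplex PEmpty.{u + 1}).cls
  mul_assoc a b c := by
    induction a, b, c using Quotient.inductionOn₃ with
    | h Γ Θ Ξ => exact Quotient.sound (disjUnion_assoc _ _ _)
  mul_comm a b := by
    induction a, b using Quotient.inductionOn₂ with
    | h Γ Θ => exact Quotient.sound (disjUnion_comm _ _)
  one_mul a := by
    induction a using Quotient.inductionOn with
    | h Γ => exact Quotient.sound ((disjUnion_comm _ _).trans (disjUnion_empty _ _))
  mul_one a := by
    induction a using Quotient.inductionOn with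
    | h Γ => exact Quotient.sound (disjUnion_empty _ _)

theorem ComplexClass.cls_mul_cls {V W : Type u} [Finite V] [Finite W]
    (K : AbstractSimplicialComplex V) (L : AbstractSimplicialComplex W) :
    K.cls * L.cls = (K.disjUnion L).cls :=
  Quotient.sound (.refl _)

theorem ComplexClass.cls_eq_one {V : Type u} [IsEmpty V] (K : AbstractSimplicialComplex V) :
    K.cls = 1 := cls_of_isEmpty _ _

/-- The underlying vector space of the Hopf algebra `𝒜` of simplicial complexes over `𝕜`: it has
the isomorphism classes of finite simplicial complexes as a basis. As an algebra it is the monoid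
algebra of these classes under disjoint union, but its coproduct is not the grouplike one, hence
the type synonym. -/
def SimplicialHopf (𝕜 : Type v) [Field 𝕜] : Type (max v (u + 1)) :=
  MonoidAlgebra 𝕜 ComplexClass.{u}

namespace SimplicialHopf

variable (𝕜 : Type v) [Field 𝕜]

instance : CommRing (SimplicialHopf.{u} 𝕜) :=
  inferInstanceAs (CommRing (MonoidAlgebra 𝕜 ComplexClass.{u}))

instance : Algebra 𝕜 (SimplicialHopf.{u} 𝕜) :=
  inferInstanceAs (Algebra 𝕜 (MonoidAlgebra 𝕜 ComplexClass.{u}))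

/-- The basis element of `𝒜` given by an isomorphism class. -/
def ofClass : ComplexClass.{u} →* SimplicialHopf.{u} 𝕜 := MonoidAlgebra.of 𝕜 ComplexClass.{u}

/-- The basis element `[Γ]` of `𝒜` given by a finite complex `Γ`. -/
def of {V : Type u} [Finite V] (K : AbstractSimplicialComplex V) : SimplicialHopf.{u} 𝕜 :=
  ofClass 𝕜 K.cls

/-- The algebra homomorphism out of `𝒜` with prescribed values on the basis. -/
def liftHom {A : Type*} [Semiring A] [Algebra 𝕜 A] (f : ComplexClass.{u} →* A) :
    SimplicialHopf.{u} 𝕜 →ₐ[𝕜] A :=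
  MonoidAlgebra.lift 𝕜 A ComplexClass.{u} f

/-- The linear map out of `𝒜` with prescribed values on the basis. -/
def liftLinear {M : Type*} [AddCommMonoid M] [Module 𝕜 M] (f : ComplexClass.{u} → M) :
    SimplicialHopf.{u} 𝕜 →ₗ[𝕜] M :=
  Finsupp.linearCombination 𝕜 f ∘ₗ
    (MonoidAlgebra.coeffLinearEquiv 𝕜 : MonoidAlgebra 𝕜 ComplexClass.{u} ≃ₗ[𝕜] _).toLinearMap

variable {𝕜}

theorem liftHom_of {A : Type*} [Semiring A] [Algebra 𝕜 A] (f : ComplexClass.{u} →* A)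
    {V : Type u} [Finite V] (K : AbstractSimplicialComplex V) :
    liftHom 𝕜 f (of 𝕜 K) = f K.cls :=
  MonoidAlgebra.lift_of f K.cls

theorem liftLinear_of {M : Type*} [AddCommMonoid M] [Module 𝕜 M] (f : ComplexClass.{u} → M)
    {V : Type u} [Finite V] (K : AbstractSimplicialComplex V) :
    liftLinear 𝕜 f (of 𝕜 K) = f K.cls := by
  refine (Finsupp.linearCombination_single 𝕜 (1 : 𝕜) K.cls).trans ?_
  rw [one_smul]

theorem algHom_ext {A : Type*} [Semiring A] [Algebra 𝕜 A] {f g : SimplicialHopf.{u} 𝕜 →ₐ[𝕜] A}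
    (h : ∀ (V : Type u) [Fintype V] (K : AbstractSimplicialComplex V), f (of 𝕜 K) = g (of 𝕜 K)) :
    f = g := by
  refine MonoidAlgebra.algHom_ext (M := ComplexClass.{u}) (fun m => ?_) ?_
  · induction m using cls_ind with
    | h V K => exact h V K
  · ext

theorem linearMap_ext {M : Type*} [AddCommMonoid M] [Module 𝕜 M]
    {f g : SimplicialHopf.{u} 𝕜 →ₗ[𝕜] M}
    (h : ∀ (V : Type u) [Fintype V] (K : AbstractSimplicialComplex V), f (of 𝕜 K) = g (of 𝕜 K)) :
    f = g := by
  refine MonoidAlgebra.lhom_ext' (M := ComplexClass.{u}) (fun m => ?_)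
  ext
  induction m using cls_ind with
  | h V K => exact h V K

theorem of_eq {V W : Type u} [Finite V] [Finite W] {K : AbstractSimplicialComplex V}
    {L : AbstractSimplicialComplex W} (h : K.cls = L.cls) : of 𝕜 K = of 𝕜 L :=
  congrArg (ofClass 𝕜) h

theorem of_mul_of {V W : Type u} [Finite V] [Finite W] (K : AbstractSimplicialComplex V)
    (L : AbstractSimplicialComplex W) : of 𝕜 K * of 𝕜 L = of 𝕜 (K.disjUnion L) := by
  rw [of, of, of, ← map_mul, ComplexClass.cls_mul_cls]

theorem of_eq_one {V : Type u} [IsEmpty V] (K : AbstractSimplicialComplex V) :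
    of 𝕜 K = 1 := by
  rw [of, ComplexClass.cls_eq_one, map_one]

theorem of_induce_of_eq_empty {V : Type u} [Finite V] (K : AbstractSimplicialComplex V)
    {T : Set V} (h : T = ∅) : of 𝕜 (K.induce T) = 1 := by
  subst h
  exact of_eq_one _

variable (𝕜) in
/-- `Σ_{T ⊆ V(Γ)} [Γ_T] ⊗ [Γ_{V(Γ) - T}]` -/
def coprod {V : Type u} [Fintype V] (K : AbstractSimplicialComplex V) :
    SimplicialHopf.{u} 𝕜 ⊗[𝕜] SimplicialHopf.{u} 𝕜 :=
  ∑ T : Set V, of 𝕜 (K.induce T) ⊗ₜ[𝕜] of 𝕜 (K.induce Tᶜ)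

/-- The restrictions of isomorphic complexes to corresponding vertex sets are isomorphic. -/
theorem cls_induce_preimage {V W : Type u} [Finite V] [Finite W]
    {K : AbstractSimplicialComplex V} {L : AbstractSimplicialComplex W} (e : V ≃ W)
    (he : ∀ s : Finset V, s.map e.toEmbedding ∈ L.faces ↔ s ∈ K.faces) (T : Set W) :
    (K.induce (e ⁻¹' T)).cls = (L.induce T).cls := by
  refine cls_eq_iff.2 ⟨e.subtypeEquiv fun _ => Iff.rfl, fun s => ?_⟩
  rw [induce, induce, mem_comap, mem_comap, ← he, Finset.map_map, Finset.map_map]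
  rfl

theorem coprod_congr {V W : Type u} [Fintype V] [Fintype W] {K : AbstractSimplicialComplex V}
    {L : AbstractSimplicialComplex W} (h : K.Isomorphic L) : coprod 𝕜 K = coprod 𝕜 L := by
  obtain ⟨e, he⟩ := h
  refine (Fintype.sum_equiv (Equiv.Set.congr e).symm _ _ fun T => ?_).symm
  have h1 : (Equiv.Set.congr e).symm T = e ⁻¹' T := by
    simp [Equiv.Set.congr, Equiv.image_eq_preimage_symm]
  rw [h1, of_eq (cls_induce_preimage e he T)]
  congr 1
  exact (of_eq (cls_induce_preimage e he Tᶜ)).symm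

theorem coprod_disjUnion {V W : Type u} [Fintype V] [Fintype W] (K : AbstractSimplicialComplex V)
    (L : AbstractSimplicialComplex W) :
    coprod 𝕜 (K.disjUnion L) = coprod 𝕜 K * coprod 𝕜 L := by
  rw [coprod, coprod, coprod, Fintype.sum_mul_sum, ← Fintype.sum_prod_type']
  refine Fintype.sum_equiv Set.sumEquiv.toEquiv _ _ fun T => ?_
  rw [Algebra.TensorProduct.tmul_mul_tmul, of_mul_of, of_mul_of]
  congr 1
  · refine of_eq ((cls_eq_iff.2 (induce_disjUnion K L _ _)).trans (cls_induce_congr _ ?_)).symm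
    ext x
    rcases x with x | x <;> simp [Set.sumEquiv]
  · refine of_eq ((cls_eq_iff.2 (induce_disjUnion K L _ _)).trans (cls_induce_congr _ ?_)).symm
    ext x
    rcases x with x | x <;> simp [Set.sumEquiv]

theorem coprod_of_isEmpty {V : Type u} [Fintype V] [IsEmpty V] (K : AbstractSimplicialComplex V) :
    coprod 𝕜 K = 1 := by
  rw [coprod, Fintype.sum_unique, of_eq_one, of_eq_one]
  rfl

variable (𝕜) in
/-- The coproduct `Δ[Γ] = Σ_{T ⊆ V(Γ)} [Γ_T] ⊗ [Γ_{V(Γ) - T}]`. -/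
def comulHom : SimplicialHopf.{u} 𝕜 →ₐ[𝕜] SimplicialHopf.{u} 𝕜 ⊗[𝕜] SimplicialHopf.{u} 𝕜 :=
  liftHom 𝕜
    { toFun := Quotient.lift (fun Γ => coprod 𝕜 Γ.complex) (fun _ _ h => coprod_congr h)
      map_one' := @coprod_of_isEmpty 𝕜 _ PEmpty.{u + 1} (_) _ _
      map_mul' := fun a b => by
        induction a, b using Quotient.inductionOn₂ with
        | h Γ Θ => exact coprod_disjUnion _ _ }

theorem comulHom_of {V : Type u} [Fintype V] (K : AbstractSimplicialComplex V) :
    comulHom 𝕜 (of 𝕜 K) = coprod 𝕜 K := by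
  rw [comulHom, liftHom_of]
  exact @coprod_congr 𝕜 _ V V (_) _ K K (.refl K)

open Classical in
variable (𝕜) in
/-- The counit: `ε[Γ]` is `1` if `Γ` has no vertices, and `0` otherwise. -/
def counitHom : SimplicialHopf.{u} 𝕜 →ₐ[𝕜] 𝕜 :=
  liftHom 𝕜
    { toFun := Quotient.lift (fun Γ => if IsEmpty Γ.V then 1 else 0) (by
        rintro Γ Θ ⟨e, -⟩
        simp only [e.isEmpty_congr])
      map_one' := if_pos (inferInstanceAs (IsEmpty PEmpty.{u + 1}))
      map_mul' := fun a b => by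
        induction a, b using Quotient.inductionOn₂ with
        | h Γ Θ =>
          change (if IsEmpty (Γ.V ⊕ Θ.V) then (1 : 𝕜) else 0) =
            (if IsEmpty Γ.V then 1 else 0) * (if IsEmpty Θ.V then 1 else 0)
          simp only [isEmpty_sum, ite_and, ite_mul, one_mul, zero_mul] }

open Classical in
theorem counitHom_of {V : Type u} [Fintype V] (K : AbstractSimplicialComplex V) :
    counitHom 𝕜 (of 𝕜 K) = if IsEmpty V then 1 else 0 := by
  rw [counitHom, liftHom_of]
  rfl

open Classical in
theorem counitHom_of_induce {V : Type u} [Fintype V] (K : AbstractSimplicialComplex V)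
    (T : Set V) : counitHom 𝕜 (of 𝕜 (K.induce T)) = if T = ∅ then 1 else 0 := by
  rw [counitHom_of]
  simp only [Set.isEmpty_coe_sort]

open Classical in
theorem sum_sets_subtype {V M : Type*} [Fintype V] [AddCommMonoid M] (T : Set V)
    [Fintype T] (f : Set V → M) :
    ∑ U : Set T, f (Subtype.val '' U) = ∑ U : Set V with U ⊆ T, f U := by
  refine Finset.sum_bij' (fun U _ => Subtype.val '' U) (fun U _ => Subtype.val ⁻¹' U)
    ?_ ?_ ?_ ?_ ?_
  · intro U _
    simp
  · intro U _
    simp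
  · intro U _
    exact Set.preimage_image_eq U Subtype.val_injective
  · intro U hU
    simpa using hU
  · intro U _
    rfl

open Classical in
theorem coprod_induce {V : Type u} [Fintype V] (K : AbstractSimplicialComplex V) (T : Set V)
    [Fintype T] :
    coprod 𝕜 (K.induce T) =
      ∑ U : Set V with U ⊆ T, of 𝕜 (K.induce U) ⊗ₜ[𝕜] of 𝕜 (K.induce (T \ U)) := by
  rw [← sum_sets_subtype T fun U => of 𝕜 (K.induce U) ⊗ₜ[𝕜] of 𝕜 (K.induce (T \ U)), coprod]
  refine Fintype.sum_congr _ _ fun U => ?_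
  congr 1
  · exact of_eq (cls_induce_induce K T U)
  · refine of_eq ((cls_induce_induce K T Uᶜ).trans (cls_induce_congr K ?_))
    ext x
    simp

theorem coassoc_of {V : Type u} [Fintype V] (K : AbstractSimplicialComplex V) :
    Algebra.TensorProduct.assoc 𝕜 𝕜 𝕜 _ _ _
      (Algebra.TensorProduct.map (comulHom 𝕜) (.id 𝕜 _) (coprod 𝕜 K)) =
    Algebra.TensorProduct.map (.id 𝕜 _) (comulHom 𝕜) (coprod 𝕜 K) := by
  classical
  rw [coprod]
  simp only [map_sum, Algebra.TensorProduct.map_tmul, comulHom_of, AlgHom.id_apply]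
  simp only [coprod_induce, TensorProduct.sum_tmul, TensorProduct.tmul_sum, map_sum,
    Algebra.TensorProduct.assoc_tmul]
  rw [Finset.sum_sigma', Finset.sum_sigma']
  refine Finset.sum_bij' (fun p _ => ⟨p.2, p.1 \ p.2⟩) (fun p _ => ⟨p.1 ∪ p.2, p.1⟩) ?_ ?_ ?_ ?_ ?_
  · rintro ⟨T, U⟩ h
    simp only [Finset.mem_sigma, Finset.mem_univ, Finset.mem_filter, true_and] at h ⊢
    exact fun x hx => hx.2
  · rintro ⟨T, U⟩ h
    simp only [Finset.mem_sigma, Finset.mem_univ, Finset.mem_filter, true_and] at h ⊢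
    exact Set.subset_union_left
  · rintro ⟨T, U⟩ h
    simp only [Finset.mem_sigma, Finset.mem_univ, Finset.mem_filter, true_and] at h ⊢
    simp [Set.union_eq_self_of_subset_left h]
  · rintro ⟨T, U⟩ h
    simp only [Finset.mem_sigma, Finset.mem_univ, Finset.mem_filter, true_and] at h ⊢
    have : (T ∪ U) \ T = U := by
      ext x
      have := @h x
      simp only [Set.mem_compl_iff] at this
      simp only [Set.mem_sdiff, Set.mem_union]
      tauto
    simp [this]
  · rintro ⟨T, U⟩ h
    simp only [Finset.mem_sigma, Finset.mem_univ, Finset.mem_filter, true_and] at h ⊢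
    congr 2
    refine of_eq (cls_induce_congr K ?_)
    ext x
    have := @h x
    simp only [Set.mem_sdiff, Set.mem_compl_iff]
    tauto

instance : Bialgebra 𝕜 (SimplicialHopf.{u} 𝕜) :=
  Bialgebra.ofAlgHom (comulHom 𝕜) (counitHom 𝕜)
    (algHom_ext fun V _ K => by
      rw [AlgHom.comp_apply, AlgHom.comp_apply, AlgHom.comp_apply, comulHom_of]
      exact coassoc_of K)
    (algHom_ext fun V _ K => by
      classical
      simp only [AlgHom.comp_apply, comulHom_of, coprod, map_sum, Algebra.TensorProduct.map_tmul,
        counitHom_of_induce, AlgHom.id_apply]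
      rw [Finset.sum_eq_single ∅ (fun T _ hT => by simp [hT]) (by simp), if_pos rfl]
      rw [of_eq ((cls_induce_congr K Set.compl_empty).trans (cls_induce_univ K))]
      rfl)
    (algHom_ext fun V _ K => by
      classical
      simp only [AlgHom.comp_apply, comulHom_of, coprod, map_sum, Algebra.TensorProduct.map_tmul,
        counitHom_of_induce, AlgHom.id_apply]
      rw [Finset.sum_eq_single Set.univ (fun T _ hT => by simp [hT]) (by simp), if_pos (by simp)]
      rw [of_eq (cls_induce_univ K)]
      rfl)

theorem comul_of {V : Type u} [Fintype V] (K : AbstractSimplicialComplex V) :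
    Coalgebra.comul (R := 𝕜) (of 𝕜 K) =
      ∑ T : Set V, of 𝕜 (K.induce T) ⊗ₜ[𝕜] of 𝕜 (K.induce Tᶜ) :=
  comulHom_of K

open Classical in
theorem counit_of {V : Type u} [Fintype V] (K : AbstractSimplicialComplex V) :
    Coalgebra.counit (R := 𝕜) (of 𝕜 K) = if IsEmpty V then 1 else 0 :=
  counitHom_of K

open Classical in
variable (𝕜) in
/-- The antipode on the basis, by the recursion available in every graded connected bialgebra:
`S[∅] = 1` and `S[Γ] = - Σ_{T ⊊ V(Γ)} S[Γ_T] [Γ_{V(Γ) - T}]` otherwise. -/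
def antipodeFun (Γ : FinComplex.{u}) : SimplicialHopf.{u} 𝕜 :=
  if IsEmpty Γ.V then 1 else
    - ∑ T : {T : Set Γ.V // T ≠ Set.univ},
      antipodeFun ⟨T.1, Γ.complex.induce T.1⟩ * of 𝕜 (Γ.complex.induce T.1ᶜ)
termination_by Fintype.card Γ.V
decreasing_by
  obtain ⟨x, hx⟩ := (Set.ne_univ_iff_exists_notMem T.1).1 T.2
  exact Fintype.card_subtype_lt hx

theorem antipodeFun_congr {Γ Θ : FinComplex.{u}} (h : Γ.complex.Isomorphic Θ.complex) :
    antipodeFun 𝕜 Γ = antipodeFun 𝕜 Θ := by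
  classical
  induction hn : Fintype.card Γ.V using Nat.strong_induction_on generalizing Γ Θ with
  | _ n ih =>
  subst hn
  obtain ⟨e, he⟩ := h
  rw [antipodeFun, antipodeFun]
  simp only [e.isEmpty_congr]
  congr 2
  have h1 (T : Set Θ.V) : (Equiv.Set.congr e).symm T = e ⁻¹' T := by
    simp [Equiv.Set.congr, Equiv.image_eq_preimage_symm]
  have h0 (T : Set Θ.V) : T ≠ Set.univ ↔ (Equiv.Set.congr e).symm T ≠ Set.univ := by
    rw [h1, Ne, Ne, Set.preimage_eq_univ_iff, e.range_eq_univ, Set.univ_subset_iff]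
  refine (Fintype.sum_equiv ((Equiv.Set.congr e).symm.subtypeEquiv h0) _ _ fun T => ?_).symm
  obtain ⟨T, hT⟩ := T
  have hT' : e ⁻¹' T ≠ Set.univ := by rw [← h1]; exact (h0 T).1 hT
  have h2 : (Equiv.Set.congr e).symm.subtypeEquiv h0 ⟨T, hT⟩ =
    (⟨e ⁻¹' T, hT'⟩ : {T : Set Γ.V // T ≠ Set.univ}) := Subtype.ext (h1 T)
  rw [h2]
  congr 1
  · refine (ih _ ?_ (cls_eq_iff.1 (cls_induce_preimage e he T)) rfl).symm
    obtain ⟨x, hx⟩ := (Set.ne_univ_iff_exists_notMem _).1 hT'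
    exact Fintype.card_subtype_lt hx
  · exact (of_eq (cls_induce_preimage e he Tᶜ)).symm

variable (𝕜) in
/-- The antipode of `𝒜`, as a linear map. -/
def antipodeLinear : SimplicialHopf.{u} 𝕜 →ₗ[𝕜] SimplicialHopf.{u} 𝕜 :=
  liftLinear 𝕜 fun x : ComplexClass.{u} =>
    Quotient.lift (antipodeFun 𝕜) (fun _ _ h => antipodeFun_congr h) x

theorem antipodeLinear_of {V : Type u} [Fintype V] (K : AbstractSimplicialComplex V) :
    antipodeLinear 𝕜 (of 𝕜 K) = antipodeFun 𝕜 ⟨V, K⟩ := by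
  rw [antipodeLinear, liftLinear_of]
  exact antipodeFun_congr (.refl K)

theorem sum_antipodeLinear_mul {V : Type u} [Fintype V] (K : AbstractSimplicialComplex V) :
    ∑ T : Set V, antipodeLinear 𝕜 (of 𝕜 (K.induce T)) * of 𝕜 (K.induce Tᶜ) =
      algebraMap 𝕜 _ (Coalgebra.counit (R := 𝕜) (of 𝕜 K)) := by
  classical
  rw [counit_of]
  rcases isEmpty_or_nonempty V with hV | hV
  · rw [Fintype.sum_unique, of_eq_one (K.induce defaultᶜ), if_pos hV, mul_one,
      antipodeLinear_of, antipodeFun, if_pos (inferInstanceAs (IsEmpty (default : Set V))), map_one]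
  · have hV' : ¬ IsEmpty V := not_isEmpty_iff.2 hV
    rw [if_neg hV', map_zero, ← Finset.add_sum_erase _ _ (Finset.mem_univ Set.univ),
      of_eq (cls_induce_univ K), antipodeLinear_of, antipodeFun, if_neg hV',
      of_induce_of_eq_empty K Set.compl_univ, mul_one, neg_add_eq_zero]
    rw [Finset.sum_subtype (p := fun T => T ≠ Set.univ) _ (fun T => by simp)]
    refine Fintype.sum_congr _ _ fun T => ?_
    rw [antipodeLinear_of]

instance : HopfAlgebra 𝕜 (SimplicialHopf.{u} 𝕜) where
  antipode := antipodeLinear 𝕜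
  mul_antipode_rTensor_comul := linearMap_ext fun V _ K => by
    simp only [LinearMap.comp_apply, comul_of, map_sum, LinearMap.rTensor_tmul,
      LinearMap.mul'_apply, Algebra.linearMap_apply]
    exact sum_antipodeLinear_mul K
  mul_antipode_lTensor_comul := linearMap_ext fun V _ K => by
    simp only [LinearMap.comp_apply, comul_of, map_sum, LinearMap.lTensor_tmul,
      LinearMap.mul'_apply, Algebra.linearMap_apply]
    rw [← sum_antipodeLinear_mul K]
    refine Fintype.sum_equiv (Equiv.ofBijective _ compl_bijective) _ _ fun T => ?_
    rw [mul_comm, Equiv.ofBijective_apply]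
    congr 1
    exact of_eq (cls_induce_congr K (compl_compl T).symm)

end SimplicialHopf

namespace SimpleGraph

variable {V : Type u}

/-- A set `F` of edges of `G` is a flat if each connected component of the graph `(V, F)` is an
induced subgraph of `G`. -/
def IsFlat (G : SimpleGraph V) (F : Set (Sym2 V)) : Prop :=
  F ⊆ G.edgeSet ∧ ∀ c : (fromEdgeSet F).ConnectedComponent,
    (fromEdgeSet F).induce c.supp = G.induce c.supp

/-- The finite set of flats of a finite graph. -/
def flats [Finite V] (G : SimpleGraph V) : Finset (Set (Sym2 V)) :=
  (Set.toFinite {F : Set (Sym2 V) | G.IsFlat F}).toFinset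

/-- The number `c(F)` of connected components of the graph `(V, F)`. -/
def numComponents (F : Set (Sym2 V)) : ℕ := Nat.card (fromEdgeSet F).ConnectedComponent

/-- The graph `G / F` obtained by contracting the edges in `F`: its vertices are the connected
components of `(V, F)`, and two distinct ones are adjacent iff an edge of `G` joins them. -/
def contract (G : SimpleGraph V) (F : Set (Sym2 V)) :
    SimpleGraph (fromEdgeSet F).ConnectedComponent :=
  G.map (fromEdgeSet F).connectedComponentMk

/-- `D` is an orientation of `G`: it contains each edge of `G` in exactly one of its two
directions, and nothing else. -/
def IsOrientation (G : SimpleGraph V) (D : Digraph V) : Prop :=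
  (∀ v w, G.Adj v w ↔ D.Adj v w ∨ D.Adj w v) ∧ ∀ v w, D.Adj v w → ¬ D.Adj w v

/-- The number `a(G)` of acyclic orientations of `G`, i.e. of those without directed cycles. -/
def numAcyclicOrientations (G : SimpleGraph V) : ℕ :=
  Nat.card {D : Digraph V // G.IsOrientation D ∧ ∀ v, ¬ Relation.TransGen D.Adj v v}

end SimpleGraph

end

/-!
A flat `F` of a graph `G` together with an acyclic orientation of `G / F` is the same thing as a
choice, for every edge of `G`, of one or both directions such that all edges on directed closed
walks get both directions: `F` is the set of edges with both directions, and the vertices of `G / F`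
are the strongly connected components. The right-hand side of the formula is therefore the sum
`P(Γ)` of the terms `(-1) ^ c(F) Γ_{V,F}` over all such partial orientations of the `1`-skeleton.

The antipode is determined by the recursion `∑ Γ_U · S(Γ_{V ∖ U}) = 0` over the subsets `U` of a
nonempty vertex set. A partial orientation of the `1`-skeleton of `Γ_{V ∖ U}` extends uniquely to
one of the `1`-skeleton of `Γ` for which every edge inside of `U` has both directions and every edge
between `U` and its complement leaves `U`. Hence `∑ Γ_U · P(Γ_{V ∖ U})` is a sum over pairs of a
partial orientation and a set `U` that is initial for it, in which the sign depends on `U` through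
the number of components inside of `U`. For a fixed partial orientation, adding or removing a
strongly connected component that no arrow enters is a sign-reversing involution of the initial
sets, so that `P` satisfies the recursion.

All terms with isomorphic `Γ_{V,F}` have the same sign since `c(F)` is the number of connected
components of the `1`-skeleton of `Γ_{V,F}`.
-/

open AbstractSimplicialComplex Relation SimpleGraph
open scoped symmDiff

section Relations

variable {V : Type*} {r : V → V → Prop}

theorem exists_forall_reflTransGen_swap [Finite V] [Nonempty V] (r : V → V → Prop) :
    ∃ s, ∀ v, ReflTransGen r v s → ReflTransGen r s v := by
  obtain ⟨s, hs⟩ := Finite.exists_min fun s => {v | ReflTransGen r v s}.ncard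
  refine ⟨s, fun v hv => ?_⟩
  have hsub : {u | ReflTransGen r u v} ⊆ {u | ReflTransGen r u s} := fun u hu => hu.trans hv
  have hmem : s ∈ {u | ReflTransGen r u s} := ReflTransGen.refl
  rwa [← Set.eq_of_subset_of_ncard_le hsub (hs v)] at hmem

/-- A set of vertices is initial for a relation, thought of as a set of arrows, if every arrow into
it starts in it and also occurs in the opposite direction. The initial sets are the unions of
strongly connected components that no arrow enters and inside of which every arrow is mutual. -/
def IsInitialSet (r : V → V → Prop) (U : Set V) : Prop :=
  ∀ ⦃v w⦄, r v w → w ∈ U → v ∈ U ∧ r w v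

namespace IsInitialSet

variable {U C : Set V}

theorem empty : IsInitialSet r ∅ := fun _ _ _ h => h.elim

theorem symmDiff (hU : IsInitialSet r U) (hC : IsInitialSet r C) : IsInitialSet r (U ∆ C) := by
  rintro v w hvw (⟨hwU, hwC⟩ | ⟨hwC, hwU⟩)
  · obtain ⟨hvU, hwv⟩ := hU hvw hwU
    exact ⟨.inl ⟨hvU, fun hvC => hwC (hC hwv hvC).1⟩, hwv⟩
  · obtain ⟨hvC, hwv⟩ := hC hvw hwC
    exact ⟨.inr ⟨hvC, fun hvU => hwU (hU hwv hvU).1⟩, hwv⟩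

theorem mem_of_reflTransGen (hU : IsInitialSet r U) {v w : V} (h : ReflTransGen r v w)
    (hw : w ∈ U) : v ∈ U := by
  induction h using ReflTransGen.head_induction_on with
  | refl => exact hw
  | head h _ ih => exact (hU h ih).1

theorem reflTransGen_compl_iff (hU : IsInitialSet r U) {v w : ↥Uᶜ} :
    ReflTransGen (fun a b : ↥Uᶜ => r a b) v w ↔ ReflTransGen r v w := by
  refine ⟨fun h => h.lift Subtype.val fun _ _ h => h, fun h => ?_⟩
  obtain ⟨w, hw⟩ := w
  change ReflTransGen r v w at h
  induction h with
  | refl => exact .refl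
  | tail h huw ih =>
    exact (ih fun hu => v.2 (hU.mem_of_reflTransGen h hu)).tail huw

end IsInitialSet

end Relations

section Counting

variable {α β γ : Type*}

theorem card_eq_ncard_range_of_eq_iff_eq {f : α → β} {g : α → γ} (hf : Function.Surjective f)
    (h : ∀ a b, f a = f b ↔ g a = g b) : Nat.card β = (Set.range g).ncard := by
  have hker : Setoid.ker f = Setoid.ker g := Setoid.ext h
  rw [← Nat.card_congr (Setoid.quotientKerEquivOfSurjective f hf), hker,
    Nat.card_congr (Setoid.quotientKerEquivRange g), Nat.card_coe_set_eq]

theorem neg_one_pow_ncard_symmDiff_singleton {R : Type*} [Monoid R] [HasDistribNeg R] [Finite α]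
    (A : Set α) (a : α) : (-1 : R) ^ (A ∆ {a}).ncard = -(-1) ^ A.ncard := by
  by_cases ha : a ∈ A
  · have hA : A ∆ {a} = A \ {a} := by
      simp [Set.symmDiff_def, Set.sdiff_eq_empty.2 (Set.singleton_subset_iff.2 ha)]
    rw [hA, ← Set.ncard_sdiff_singleton_add_one ha, pow_succ, mul_neg_one, neg_neg]
  · have hA : A ∆ {a} = insert a A := by
      rw [(Set.disjoint_singleton_right.2 ha).symmDiff_eq_sup]
      exact Set.union_singleton
    rw [hA, Set.ncard_insert_of_notMem ha, pow_succ, mul_neg_one]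

end Counting

section Flats

variable {V : Type*} {G : SimpleGraph V} {F : Set (Sym2 V)}

/-- The connected component of a vertex in the spanning subgraph with edge set `F`, i.e. the vertex
of `G.contract F` to which it is contracted. -/
def edgeComponent (F : Set (Sym2 V)) (v : V) : (fromEdgeSet F).ConnectedComponent :=
  (fromEdgeSet F).connectedComponentMk v

theorem edgeComponent_surjective : Function.Surjective (edgeComponent F) :=
  Quot.mk_surjective

theorem edgeComponent_eq_edgeComponent_iff {v w : V} :
    edgeComponent F v = edgeComponent F w ↔ (fromEdgeSet F).Reachable v w :=
  ConnectedComponent.eq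

theorem contract_adj_iff {c c' : (fromEdgeSet F).ConnectedComponent} :
    (G.contract F).Adj c c' ↔
      c ≠ c' ∧ Relation.Map G.Adj (edgeComponent F) (edgeComponent F) c c' :=
  map_adj' _ _ _ _

theorem isFlat_iff :
    G.IsFlat F ↔ ∀ v w, s(v, w) ∈ F ↔ G.Adj v w ∧ edgeComponent F v = edgeComponent F w := by
  constructor
  · rintro ⟨hsub, hind⟩ v w
    refine ⟨fun h => ?_, fun ⟨h, hc⟩ => ?_⟩
    · have hvw : (fromEdgeSet F).Adj v w := (fromEdgeSet_adj F).2 ⟨h, (hsub h : G.Adj v w).ne⟩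
      exact ⟨hsub h, edgeComponent_eq_edgeComponent_iff.2 hvw.reachable⟩
    · have hvw := congrFun₂ (congrArg Adj (hind (edgeComponent F w))) ⟨v, hc⟩ ⟨w, rfl⟩
      exact ((fromEdgeSet_adj F).1 (hvw.mpr h)).1
  · intro h
    refine ⟨fun e => ?_, fun c => ?_⟩
    · induction e with | _ v w
      exact fun he => ((h v w).1 he).1
    · ext v w
      have hc : edgeComponent F v = edgeComponent F w := v.2.trans w.2.symm
      simp only [comap_adj, Function.Embedding.subtype_apply, fromEdgeSet_adj, h]
      exact ⟨fun hvw => hvw.1.1, fun hvw => ⟨⟨hvw, hc⟩, hvw.ne⟩⟩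

theorem mem_flats [Finite V] : F ∈ G.flats ↔ G.IsFlat F := by
  rw [flats, Set.Finite.mem_toFinset, Set.mem_ofPred_eq]

theorem exists_isOrientation_and_acyclic (G : SimpleGraph V) :
    ∃ D : Digraph V, G.IsOrientation D ∧ ∀ v, ¬ TransGen D.Adj v v := by
  refine ⟨⟨fun v w => G.Adj v w ∧ WellOrderingRel v w⟩, ⟨fun v w => ⟨fun h => ?_, ?_⟩, ?_⟩, ?_⟩
  · exact (trichotomous_of WellOrderingRel v w).imp (fun hlt => ⟨h, hlt⟩)
      fun hlt => ⟨h.symm, hlt.resolve_left h.ne⟩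
  · exact Or.rec And.left fun h => h.1.symm
  · exact fun v w hvw hwv => asymm_of WellOrderingRel hvw.2 hwv.2
  · intro v hv
    have hlt : TransGen WellOrderingRel v v := TransGen.mono (fun _ _ h => h.2) _ _ hv
    rw [transGen_eq_self] at hlt
    exact irrefl_of WellOrderingRel v hlt

theorem numAcyclicOrientations_pos [Finite V] (G : SimpleGraph V) :
    0 < G.numAcyclicOrientations := by
  have hfin : Finite (Digraph V) :=
    Finite.of_injective (fun D : Digraph V => D.Adj) fun _ _ h => Digraph.ext h
  obtain ⟨D, hD⟩ := exists_isOrientation_and_acyclic G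
  exact Nat.card_pos_iff.2 ⟨⟨⟨D, hD⟩⟩, inferInstance⟩

end Flats

/-- A partial orientation of `G` keeps every edge in at least one of its two directions, and keeps
every edge that lies on a directed closed walk in both directions. It encodes a flat `F` of `G`,
namely the set of edges kept in both directions, together with an acyclic orientation of the
contraction `G / F`. -/
@[ext]
structure PartialOrientation {V : Type*} (G : SimpleGraph V) extends Digraph V where
  adj_iff : ∀ v w, G.Adj v w ↔ Adj v w ∨ Adj w v
  swap : ∀ v w, Adj v w → ReflTransGen Adj w v → Adj w v

namespace PartialOrientation

variable {V : Type*} {G : SimpleGraph V} {F : Set (Sym2 V)} {U : Set V}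

instance [Finite V] : Finite (PartialOrientation G) :=
  Finite.of_injective (fun D v w => D.Adj v w) fun _ _ => PartialOrientation.ext

noncomputable instance [Finite V] : Fintype (PartialOrientation G) :=
  Fintype.ofFinite _

instance [IsEmpty V] : Unique (PartialOrientation G) where
  default := ⟨⟨fun v _ => isEmptyElim v⟩, fun v => isEmptyElim v, fun v => isEmptyElim v⟩
  uniq _ := PartialOrientation.ext (funext fun v => isEmptyElim v)

section MutualEdges

variable (D : PartialOrientation G)

/-- The edges kept in both directions; this is the flat that belongs to a partial orientation. -/
def mutualEdges : Set (Sym2 V) :=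
  Sym2.fromRel (r := fun v w => D.Adj v w ∧ D.Adj w v) ⟨fun _ _ h => h.symm⟩

variable {D} {v w : V}

theorem mk_mem_mutualEdges : s(v, w) ∈ D.mutualEdges ↔ D.Adj v w ∧ D.Adj w v :=
  Iff.rfl

theorem adj_of_adj (h : D.Adj v w) : G.Adj v w :=
  (D.adj_iff v w).2 (.inl h)

theorem adj_of_adj_of_reflTransGen (h : G.Adj v w) (hr : ReflTransGen D.Adj v w) : D.Adj v w :=
  ((D.adj_iff v w).1 h).elim id fun h => D.swap w v h hr

theorem fromEdgeSet_mutualEdges_adj :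
    (fromEdgeSet D.mutualEdges).Adj v w ↔ D.Adj v w ∧ D.Adj w v := by
  rw [fromEdgeSet_adj, mk_mem_mutualEdges]
  exact ⟨And.left, fun h => ⟨h, (adj_of_adj h.1).ne⟩⟩

theorem edgeComponent_eq_iff :
    edgeComponent D.mutualEdges v = edgeComponent D.mutualEdges w ↔
      ReflTransGen D.Adj v w ∧ ReflTransGen D.Adj w v := by
  rw [edgeComponent_eq_edgeComponent_iff]
  constructor
  · rintro ⟨p⟩
    induction p with
    | nil => exact ⟨.refl, .refl⟩
    | cons h _ ih =>
      rw [fromEdgeSet_mutualEdges_adj] at h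
      exact ⟨.head h.1 ih.1, ih.2.tail h.2⟩
  · rintro ⟨hvw, hwv⟩
    induction hvw using ReflTransGen.head_induction_on with
    | refl => rfl
    | head h huw ih =>
      have hswap := D.swap _ _ h (huw.trans hwv)
      exact (fromEdgeSet_mutualEdges_adj.2 ⟨h, hswap⟩).reachable.trans (ih (hwv.tail h))

theorem isFlat_mutualEdges : G.IsFlat D.mutualEdges := by
  rw [isFlat_iff]
  intro v w
  rw [mk_mem_mutualEdges, edgeComponent_eq_iff]
  constructor
  · rintro ⟨hvw, hwv⟩
    exact ⟨adj_of_adj hvw, .single hvw, .single hwv⟩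
  · rintro ⟨h, hvw, hwv⟩
    exact ⟨adj_of_adj_of_reflTransGen h hvw, adj_of_adj_of_reflTransGen h.symm hwv⟩

end MutualEdges

section RestrictExtend

/-- The partial orientation of an induced subgraph obtained by forgetting all other vertices. -/
def restrict (D : PartialOrientation G) (T : Set V) : PartialOrientation (G.induce T) where
  Adj v w := D.Adj v w
  adj_iff v w := D.adj_iff v w
  swap v w h hr := D.swap v w h (hr.lift Subtype.val fun _ _ h => h)

theorem mutualEdges_restrict (D : PartialOrientation G) (T : Set V) :
    (D.restrict T).mutualEdges = Sym2.map (↑) ⁻¹' D.mutualEdges := by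
  ext e
  induction e with | _ v w
  rfl

/-- The arrows of `PartialOrientation.extend`. -/
def ExtendAdj (U : Set V) (E : PartialOrientation (G.induce Uᶜ)) (v w : V) : Prop :=
  (G.Adj v w ∧ v ∈ U) ∨ Relation.Map E.Adj (↑) (↑) v w

variable {E : PartialOrientation (G.induce Uᶜ)}

theorem extendAdj_coe_iff {v w : ↥Uᶜ} : ExtendAdj U E v w ↔ E.Adj v w := by
  rw [ExtendAdj, Relation.map_apply_apply Subtype.val_injective Subtype.val_injective]
  exact or_iff_right fun h => v.2 h.2

theorem isInitialSet_extendAdj : IsInitialSet (ExtendAdj U E) U := by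
  rintro v w (⟨h, hv⟩ | ⟨_, w, -, -, rfl⟩) hw
  · exact ⟨hv, .inl ⟨h.symm, hw⟩⟩
  · exact (w.2 hw).elim

/-- The partial orientation of `G` that extends one outside of `U` and keeps all edges of `G`
starting in `U`, hence those inside of `U` in both directions and those between `U` and its
complement in the direction that leaves `U`. -/
def extend (U : Set V) (E : PartialOrientation (G.induce Uᶜ)) : PartialOrientation G where
  Adj := ExtendAdj U E
  adj_iff v w := by
    constructor
    · intro h
      by_cases hv : v ∈ U
      · exact .inl (.inl ⟨h, hv⟩)
      by_cases hw : w ∈ U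
      · exact .inr (.inl ⟨h.symm, hw⟩)
      exact ((E.adj_iff ⟨v, hv⟩ ⟨w, hw⟩).1 h).imp extendAdj_coe_iff.2 extendAdj_coe_iff.2
    · rintro ((h | ⟨v, w, h, rfl, rfl⟩) | (h | ⟨w, v, h, rfl, rfl⟩))
      exacts [h.1, (E.adj_iff v w).2 (.inl h), h.1.symm, (E.adj_iff v w).2 (.inr h)]
  swap v w h hr := by
    rcases h with ⟨h, hv⟩ | ⟨v, w, h, rfl, rfl⟩
    · exact .inl ⟨h.symm, isInitialSet_extendAdj.mem_of_reflTransGen hr hv⟩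
    · rw [← isInitialSet_extendAdj.reflTransGen_compl_iff] at hr
      simp only [extendAdj_coe_iff] at hr
      exact extendAdj_coe_iff.2 (E.swap v w h hr)

theorem restrict_extend : (E.extend U).restrict Uᶜ = E :=
  PartialOrientation.ext (funext₂ fun _ _ => propext extendAdj_coe_iff)

variable {D : PartialOrientation G}

theorem adj_iff_of_isInitialSet (hU : IsInitialSet D.Adj U) {v w : V} (hv : v ∈ U) :
    D.Adj v w ↔ G.Adj v w :=
  ⟨adj_of_adj, fun h => ((D.adj_iff v w).1 h).elim id fun h => (hU h hv).2⟩

theorem extend_restrict (hU : IsInitialSet D.Adj U) : (D.restrict Uᶜ).extend U = D := by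
  refine PartialOrientation.ext (funext₂ fun v w => propext ⟨?_, fun h => ?_⟩)
  · rintro (⟨h, hv⟩ | ⟨v, w, h, rfl, rfl⟩)
    exacts [(adj_iff_of_isInitialSet hU hv).2 h, h]
  · by_cases hv : v ∈ U
    · exact .inl ⟨adj_of_adj h, hv⟩
    · exact .inr ⟨⟨v, hv⟩, ⟨w, fun hw => hv (hU h hw).1⟩, h, rfl, rfl⟩

/-- The partial orientations outside of `U` are the partial orientations of `G` for which `U` is
initial. -/
@[simps]
def extendEquiv (G : SimpleGraph V) (U : Set V) :
    PartialOrientation (G.induce Uᶜ) ≃ {D : PartialOrientation G // IsInitialSet D.Adj U} where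
  toFun E := ⟨E.extend U, isInitialSet_extendAdj⟩
  invFun D := D.1.restrict Uᶜ
  left_inv _ := restrict_extend
  right_inv D := Subtype.ext (extend_restrict D.2)

theorem edgeComponent_restrict_eq_iff (hU : IsInitialSet D.Adj U) {v w : ↥Uᶜ} :
    edgeComponent (D.restrict Uᶜ).mutualEdges v = edgeComponent (D.restrict Uᶜ).mutualEdges w ↔
      edgeComponent D.mutualEdges v = edgeComponent D.mutualEdges (w : V) := by
  rw [edgeComponent_eq_iff, edgeComponent_eq_iff]
  exact and_congr hU.reflTransGen_compl_iff hU.reflTransGen_compl_iff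

theorem preimage_image_edgeComponent (hU : IsInitialSet D.Adj U) :
    edgeComponent D.mutualEdges ⁻¹' (edgeComponent D.mutualEdges '' U) = U := by
  refine Set.Subset.antisymm ?_ (Set.subset_preimage_image _ _)
  rintro v ⟨u, hu, huv⟩
  exact hU.mem_of_reflTransGen (edgeComponent_eq_iff.1 huv).2 hu

theorem ncard_image_add_numComponents_restrict [Finite V] (hU : IsInitialSet D.Adj U) :
    (edgeComponent D.mutualEdges '' U).ncard + numComponents (D.restrict Uᶜ).mutualEdges =
      numComponents D.mutualEdges := by
  have hcompl : Set.range (fun v : ↥Uᶜ => edgeComponent D.mutualEdges (v : V)) =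
      (edgeComponent D.mutualEdges '' U)ᶜ := by
    rw [← Set.image_eq_range, ← preimage_image_edgeComponent hU, ← Set.preimage_compl,
      Set.image_preimage_eq _ edgeComponent_surjective, preimage_image_edgeComponent hU]
  rw [numComponents, card_eq_ncard_range_of_eq_iff_eq edgeComponent_surjective
    fun _ _ => edgeComponent_restrict_eq_iff hU, hcompl, Set.ncard_add_ncard_compl]
  rfl

end RestrictExtend

section InitialSets

variable {D : PartialOrientation G} {s : V}

theorem isInitialSet_preimage_edgeComponent
    (hs : ∀ v, ReflTransGen D.Adj v s → ReflTransGen D.Adj s v) :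
    IsInitialSet D.Adj (edgeComponent D.mutualEdges ⁻¹' {edgeComponent D.mutualEdges s}) := by
  intro v w h hw
  have hws := (edgeComponent_eq_iff.1 hw).1
  have hvs := hws.head h
  exact ⟨edgeComponent_eq_iff.2 ⟨hvs, hs v hvs⟩, D.swap v w h (hws.trans (hs v hvs))⟩

theorem image_edgeComponent_symmDiff (hU : IsInitialSet D.Adj U) (s : V) :
    edgeComponent D.mutualEdges ''
        (U ∆ (edgeComponent D.mutualEdges ⁻¹' {edgeComponent D.mutualEdges s})) =
      (edgeComponent D.mutualEdges '' U) ∆ {edgeComponent D.mutualEdges s} := by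
  conv_lhs => rw [← preimage_image_edgeComponent hU, ← Set.preimage_symmDiff]
  exact Set.image_preimage_eq _ edgeComponent_surjective

open Classical in
theorem sum_neg_one_pow_ncard_image_edgeComponent {R : Type*} [Ring R] [Fintype V] [Nonempty V]
    (D : PartialOrientation G) :
    ∑ U : Set V with IsInitialSet D.Adj U,
      (-1 : R) ^ (edgeComponent D.mutualEdges '' U).ncard = 0 := by
  obtain ⟨s, hs⟩ := exists_forall_reflTransGen_swap D.Adj
  let C := edgeComponent D.mutualEdges ⁻¹' {edgeComponent D.mutualEdges s}
  have hC : C.Nonempty := ⟨s, rfl⟩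
  refine Finset.sum_involution (fun U _ => U ∆ C) (fun U hU => ?_) (fun U _ _ => ?_)
    (fun U hU => ?_) fun U _ => symmDiff_symmDiff_cancel_right C U
  · rw [image_edgeComponent_symmDiff (Finset.mem_filter_univ U |>.1 hU),
      neg_one_pow_ncard_symmDiff_singleton, add_neg_cancel]
  · exact fun h => hC.ne_empty (symmDiff_eq_left.1 h)
  · rw [Finset.mem_filter_univ] at hU ⊢
    exact hU.symmDiff (isInitialSet_preimage_edgeComponent hs)

end InitialSets

section Contract

variable {O : Digraph (fromEdgeSet F).ConnectedComponent}

theorem reflTransGen_edgeComponent {r : V → V → Prop}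
    (hr : ∀ v w, r v w → edgeComponent F v = edgeComponent F w ∨
      O.Adj (edgeComponent F v) (edgeComponent F w)) {v w : V} (h : ReflTransGen r v w) :
    ReflTransGen O.Adj (edgeComponent F v) (edgeComponent F w) := by
  refine h.lift' (edgeComponent F) fun v w h => ?_
  rcases hr v w h with hc | hO
  · rw [Function.onFun, hc]
  · exact .single hO

/-- The partial orientation that keeps the edges inside of the components of `F` in both directions
and the other edges in the direction prescribed by an acyclic orientation of `G.contract F`. -/
def ofContract (hO : (G.contract F).IsOrientation O) (hac : ∀ c, ¬ TransGen O.Adj c c) :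
    PartialOrientation G where
  Adj v w := G.Adj v w ∧ (edgeComponent F v = edgeComponent F w ∨
    O.Adj (edgeComponent F v) (edgeComponent F w))
  adj_iff v w := by
    refine ⟨fun h => ?_, fun h => h.elim And.left fun h => h.1.symm⟩
    by_cases hc : edgeComponent F v = edgeComponent F w
    · exact .inl ⟨h, .inl hc⟩
    · exact ((hO.1 _ _).1 (contract_adj_iff.2 ⟨hc, v, w, h, rfl, rfl⟩)).imp
        (fun h' => ⟨h, .inr h'⟩) fun h' => ⟨h.symm, .inr h'⟩
  swap v w h hr := by
    refine ⟨h.1.symm, .inl (h.2.resolve_right fun hvw => hac _ (.head' hvw ?_)).symm⟩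
    exact reflTransGen_edgeComponent (fun _ _ => And.right) hr

section OfContract

variable (hO : (G.contract F).IsOrientation O) (hac : ∀ c, ¬ TransGen O.Adj c c)

theorem mutualEdges_ofContract (hF : G.IsFlat F) : (ofContract hO hac).mutualEdges = F := by
  ext e
  induction e with | _ v w
  rw [isFlat_iff.1 hF, mk_mem_mutualEdges]
  constructor
  · rintro ⟨⟨h, hvw⟩, -, hwv⟩
    exact ⟨h, hvw.elim id fun hvw => (hwv.resolve_right (hO.2 _ _ hvw)).symm⟩
  · rintro ⟨h, hc⟩
    exact ⟨⟨h, .inl hc⟩, h.symm, .inl hc.symm⟩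

theorem adj_iff_ofContract (c c' : (fromEdgeSet F).ConnectedComponent) :
    O.Adj c c' ↔ c ≠ c' ∧
      Relation.Map (ofContract hO hac).Adj (edgeComponent F) (edgeComponent F) c c' := by
  constructor
  · intro h
    obtain ⟨hne, v, w, hvw, rfl, rfl⟩ := contract_adj_iff.1 ((hO.1 c c').2 (.inl h))
    exact ⟨hne, v, w, ⟨hvw, .inr h⟩, rfl, rfl⟩
  · rintro ⟨hne, v, w, h, rfl, rfl⟩
    exact h.2.resolve_left hne

end OfContract

/-- The acyclic orientation that a partial orientation induces on the contraction by the edges kept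
in both directions. -/
def toContract (D : PartialOrientation G) :
    Digraph (fromEdgeSet D.mutualEdges).ConnectedComponent where
  Adj c c' := c ≠ c' ∧
    Relation.Map D.Adj (edgeComponent D.mutualEdges) (edgeComponent D.mutualEdges) c c'

variable (D : PartialOrientation G)

theorem reflTransGen_of_toContract {v w : V} (h : ReflTransGen D.toContract.Adj
    (edgeComponent D.mutualEdges v) (edgeComponent D.mutualEdges w)) :
    ReflTransGen D.Adj v w := by
  generalize hc : edgeComponent D.mutualEdges w = c at h
  induction h generalizing w with
  | refl => exact (edgeComponent_eq_iff.1 hc).2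
  | tail _ h ih =>
    obtain ⟨-, x, y, hxy, rfl, rfl⟩ := h
    exact ((ih rfl).tail hxy).trans (edgeComponent_eq_iff.1 hc).2

theorem not_reflTransGen_toContract_of_adj {c c' : (fromEdgeSet D.mutualEdges).ConnectedComponent}
    (h : D.toContract.Adj c c') : ¬ ReflTransGen D.toContract.Adj c' c := by
  obtain ⟨hne, v, w, hvw, rfl, rfl⟩ := h
  exact fun hr => hne (edgeComponent_eq_iff.2 ⟨.single hvw, D.reflTransGen_of_toContract hr⟩)

theorem isOrientation_toContract : (G.contract D.mutualEdges).IsOrientation D.toContract := by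
  refine ⟨fun c c' => contract_adj_iff.trans ⟨?_, ?_⟩, fun c c' h h' =>
    D.not_reflTransGen_toContract_of_adj h (.single h')⟩
  · rintro ⟨hne, v, w, hvw, rfl, rfl⟩
    exact ((D.adj_iff v w).1 hvw).imp (fun h => ⟨hne, v, w, h, rfl, rfl⟩)
      fun h => ⟨hne.symm, w, v, h, rfl, rfl⟩
  · rintro (⟨hne, v, w, h, rfl, rfl⟩ | ⟨hne, v, w, h, rfl, rfl⟩)
    exacts [⟨hne, v, w, adj_of_adj h, rfl, rfl⟩, ⟨hne.symm, w, v, (adj_of_adj h).symm, rfl, rfl⟩]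

theorem acyclic_toContract (c : (fromEdgeSet D.mutualEdges).ConnectedComponent) :
    ¬ TransGen D.toContract.Adj c c := by
  intro h
  obtain ⟨c', hcc', hc'c⟩ := TransGen.head'_iff.1 h
  exact D.not_reflTransGen_toContract_of_adj hcc' hc'c

theorem ofContract_toContract :
    ofContract D.isOrientation_toContract D.acyclic_toContract = D := by
  refine PartialOrientation.ext (funext₂ fun v w => propext ⟨?_, fun h => ?_⟩)
  · rintro ⟨h, hc | hO⟩
    · exact adj_of_adj_of_reflTransGen h (edgeComponent_eq_iff.1 hc).1
    · exact adj_of_adj_of_reflTransGen h (D.reflTransGen_of_toContract (.single hO))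
  · exact ⟨adj_of_adj h, or_iff_not_imp_left.2 fun hne => ⟨hne, v, w, h, rfl, rfl⟩⟩

theorem card_mutualEdges_eq (hF : G.IsFlat F) :
    Nat.card {D : PartialOrientation G // D.mutualEdges = F} =
      (G.contract F).numAcyclicOrientations := by
  refine (Nat.card_eq_of_bijective
    (fun O : {O : Digraph _ // (G.contract F).IsOrientation O ∧ ∀ c, ¬ TransGen O.Adj c c} =>
      (⟨ofContract O.2.1 O.2.2, mutualEdges_ofContract O.2.1 O.2.2 hF⟩ :
        {D : PartialOrientation G // D.mutualEdges = F})) ⟨?_, ?_⟩).symm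
  · rintro ⟨O, hO⟩ ⟨O', hO'⟩ h
    have h : ofContract hO.1 hO.2 = ofContract hO'.1 hO'.2 := congrArg Subtype.val h
    refine Subtype.ext (Digraph.ext (funext₂ fun c c' => propext ?_))
    rw [adj_iff_ofContract hO.1 hO.2, h, ← adj_iff_ofContract hO'.1 hO'.2]
  · rintro ⟨D, rfl⟩
    exact ⟨⟨D.toContract, D.isOrientation_toContract, D.acyclic_toContract⟩,
      Subtype.ext D.ofContract_toContract⟩

theorem sum_mutualEdges [Finite V] {M : Type*} [AddCommMonoid M] (f : Set (Sym2 V) → M) :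
    ∑ D : PartialOrientation G, f D.mutualEdges =
      ∑ F ∈ G.flats, (G.contract F).numAcyclicOrientations • f F := by
  classical
  rw [← Finset.sum_fiberwise_of_maps_to' (t := G.flats)
    (fun D _ => mem_flats.2 D.isFlat_mutualEdges)]
  refine Finset.sum_congr rfl fun F hF => ?_
  rw [Finset.sum_const, ← card_mutualEdges_eq (mem_flats.1 hF), Nat.card_eq_fintype_card,
    Fintype.card_subtype]

end Contract

end PartialOrientation

section Complexes

variable {V : Type u} {K : AbstractSimplicialComplex V} {F : Set (Sym2 V)}

theorem oneSkeleton_adj_of_mem_faces {s : Finset V} (hs : s ∈ K.faces) {v w : V} (hv : v ∈ s)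
    (hw : w ∈ s) (hvw : v ≠ w) : K.oneSkeleton.Adj v w := by
  classical
  have hsub : {v, w} ⊆ s := Finset.insert_subset hv (Finset.singleton_subset_iff.2 hw)
  exact ⟨hvw, (K.isRelLowerSet_faces hs).2 hsub (Finset.insert_nonempty _ _)⟩

theorem oneSkeleton_comap {W : Type u} (K : AbstractSimplicialComplex V) (f : W ↪ V) :
    (K.comap f).oneSkeleton = K.oneSkeleton.comap f := by
  classical
  ext v w
  refine and_congr f.injective.ne_iff.symm ?_
  rw [mem_comap]
  simp

theorem oneSkeleton_induce (K : AbstractSimplicialComplex V) (T : Set V) :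
    (K.induce T).oneSkeleton = K.oneSkeleton.induce T :=
  oneSkeleton_comap K _

theorem oneSkeleton_restrictEdges (hF : F ⊆ K.oneSkeleton.edgeSet) :
    (K.restrictEdges F).oneSkeleton = fromEdgeSet F := by
  classical
  ext v w
  rw [fromEdgeSet_adj]
  constructor
  · rintro ⟨hne, -, h⟩
    exact ⟨h v (by simp) w (by simp) hne, hne⟩
  · rintro ⟨h, hne⟩
    refine ⟨hne, (hF h).2, ?_⟩
    simp only [Finset.mem_insert, Finset.mem_singleton]
    rintro a (rfl | rfl) b (rfl | rfl) hab
    exacts [(hab rfl).elim, h, Sym2.eq_swap ▸ h, (hab rfl).elim]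

theorem restrictEdges_eq_self (hF : K.oneSkeleton.edgeSet ⊆ F) : K.restrictEdges F = K := by
  ext s
  exact and_iff_left_of_imp fun hs v hv w hw hvw =>
    hF (oneSkeleton_adj_of_mem_faces hs hv hw hvw : s(v, w) ∈ K.oneSkeleton.edgeSet)

theorem induce_restrictEdges (T : Set V) :
    (K.restrictEdges F).induce T = (K.induce T).restrictEdges (Sym2.map (↑) ⁻¹' F) := by
  ext s
  refine and_congr Iff.rfl ⟨fun h v hv w hw hvw => ?_, fun h => ?_⟩
  · exact h v (Finset.mem_map_of_mem _ hv) w (Finset.mem_map_of_mem _ hw)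
      (Subtype.coe_ne_coe.2 hvw)
  · simp only [Finset.mem_map]
    rintro _ ⟨v, hv, rfl⟩ _ ⟨w, hw, rfl⟩ hvw
    exact h v hv w hw (Subtype.coe_ne_coe.1 hvw)

theorem isomorphic_disjUnion_induce_compl {U : Set V}
    (hU : ∀ v w, K.oneSkeleton.Adj v w → v ∈ U → w ∈ U) :
    ((K.induce U).disjUnion (K.induce Uᶜ)).Isomorphic K := by
  classical
  have hinl : Function.Embedding.inl.trans (Equiv.Set.sumCompl U).toEmbedding =
      Function.Embedding.subtype (· ∈ U) := by ext; simp
  have hinr : Function.Embedding.inr.trans (Equiv.Set.sumCompl U).toEmbedding =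
      Function.Embedding.subtype (· ∈ Uᶜ) := by ext; simp
  refine isomorphic_disjUnion (Equiv.Set.sumCompl U) (fun s => ?_) (fun s => ?_) fun t ht => ?_
  · rw [hinl, AbstractSimplicialComplex.induce, mem_comap]
  · rw [hinr, AbstractSimplicialComplex.induce, mem_comap]
  · rw [hinl, hinr]
    by_cases ht' : ∃ v ∈ t, v ∈ U
    · obtain ⟨v, hvt, hvU⟩ := ht'
      refine .inl ⟨t.subtype (· ∈ U), (Finset.subtype_map_of_mem fun w hwt => ?_).symm⟩
      by_cases hvw : v = w
      exacts [hvw ▸ hvU, hU v w (oneSkeleton_adj_of_mem_faces ht hvt hwt hvw) hvU]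
    · push Not at ht'
      exact .inr ⟨t.subtype (· ∈ Uᶜ), (Finset.subtype_map_of_mem ht').symm⟩

theorem nonempty_iso_oneSkeleton {W : Type u} {L : AbstractSimplicialComplex W}
    (h : K.Isomorphic L) : Nonempty (K.oneSkeleton ≃g L.oneSkeleton) := by
  classical
  obtain ⟨e, he⟩ := h
  refine ⟨e, fun {v w} => and_congr e.injective.ne_iff ?_⟩
  rw [← he, Finset.map_insert, Finset.map_singleton]
  rfl

theorem numComponents_eq_of_isomorphic_restrictEdges {F' : Set (Sym2 V)}
    (hF : F ⊆ K.oneSkeleton.edgeSet) (hF' : F' ⊆ K.oneSkeleton.edgeSet)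
    (h : (K.restrictEdges F).Isomorphic (K.restrictEdges F')) :
    numComponents F = numComponents F' := by
  obtain ⟨f⟩ := nonempty_iso_oneSkeleton h
  rw [oneSkeleton_restrictEdges hF, oneSkeleton_restrictEdges hF'] at f
  exact Nat.card_congr f.connectedComponentEquiv

end Complexes

namespace SimplicialHopf

open scoped TensorProduct

variable {𝕜 : Type v} [Field 𝕜] {V : Type u}

/-- The signed sum, over all partial orientations of the `1`-skeleton of `K`, of the complexes
`K_{V,F}` with `F` the set of edges kept in both directions. -/
noncomputable def orientationSum (𝕜 : Type v) [Field 𝕜] [Finite V]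
    (K : AbstractSimplicialComplex V) : SimplicialHopf.{u} 𝕜 :=
  ∑ D : PartialOrientation K.oneSkeleton,
    (-1 : 𝕜) ^ numComponents D.mutualEdges • of 𝕜 (K.restrictEdges D.mutualEdges)

theorem orientationSum_of_isEmpty [IsEmpty V] (K : AbstractSimplicialComplex V) :
    orientationSum 𝕜 K = 1 := by
  rw [orientationSum, Fintype.sum_unique, numComponents, Nat.card_of_isEmpty, pow_zero, one_smul,
    of_eq_one]

theorem of_mul_of_induce_compl [Finite V] {K : AbstractSimplicialComplex V} {U : Set V}
    (hU : ∀ v w, K.oneSkeleton.Adj v w → v ∈ U → w ∈ U) :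
    of 𝕜 (K.induce U) * of 𝕜 (K.induce Uᶜ) = of 𝕜 K := by
  rw [of_mul_of, of_eq (cls_eq_iff.2 (isomorphic_disjUnion_induce_compl hU))]

theorem of_induce_mul_of_restrictEdges [Finite V] {K : AbstractSimplicialComplex V} {U : Set V}
    {D : PartialOrientation K.oneSkeleton} (hU : IsInitialSet D.Adj U) :
    of 𝕜 (K.induce U) * of 𝕜 ((K.induce Uᶜ).restrictEdges (D.restrict Uᶜ).mutualEdges) =
      of 𝕜 (K.restrictEdges D.mutualEdges) := by
  have hself : (K.restrictEdges D.mutualEdges).induce U = K.induce U := by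
    rw [induce_restrictEdges]
    refine restrictEdges_eq_self fun e => ?_
    induction e with | _ v w
    rw [oneSkeleton_induce]
    intro h
    exact ⟨(PartialOrientation.adj_iff_of_isInitialSet hU v.2).2 h,
      (PartialOrientation.adj_iff_of_isInitialSet hU w.2).2 h.symm⟩
  rw [D.mutualEdges_restrict, ← hself, ← induce_restrictEdges]
  refine of_mul_of_induce_compl fun v w h hv => ?_
  rw [oneSkeleton_restrictEdges PartialOrientation.isFlat_mutualEdges.1,
    PartialOrientation.fromEdgeSet_mutualEdges_adj] at h
  exact (hU h.2 hv).1

open Classical in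
theorem of_induce_mul_orientationSum [Finite V] (K : AbstractSimplicialComplex V) (U : Set V) :
    of 𝕜 (K.induce U) * orientationSum 𝕜 (K.induce Uᶜ) =
      ∑ D : PartialOrientation K.oneSkeleton with IsInitialSet D.Adj U,
        (-1 : 𝕜) ^ (edgeComponent D.mutualEdges '' U).ncard •
          (-1 : 𝕜) ^ numComponents D.mutualEdges • of 𝕜 (K.restrictEdges D.mutualEdges) := by
  rw [orientationSum, oneSkeleton_induce, Finset.mul_sum,
    Finset.sum_subtype (p := fun D : PartialOrientation K.oneSkeleton => IsInitialSet D.Adj U)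
      _ Finset.mem_filter_univ]
  refine (Fintype.sum_equiv (PartialOrientation.extendEquiv K.oneSkeleton U).symm _ _
    fun ⟨D, hU⟩ => ?_).symm
  rw [PartialOrientation.extendEquiv_symm_apply, mul_smul_comm, of_induce_mul_of_restrictEdges hU,
    smul_smul, ← PartialOrientation.ncard_image_add_numComponents_restrict hU, pow_add,
    ← mul_assoc, ← mul_pow, neg_one_mul, neg_neg, one_pow, one_mul]

theorem of_induce_empty_mul_orientationSum [Finite V] (K : AbstractSimplicialComplex V) :
    of 𝕜 (K.induce ∅) * orientationSum 𝕜 (K.induce ∅ᶜ) = orientationSum 𝕜 K := by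
  rw [of_induce_mul_orientationSum, orientationSum]
  simp only [IsInitialSet.empty, Finset.filter_true, Set.image_empty, Set.ncard_empty, pow_zero,
    one_smul]

theorem of_induce_empty_mul_antipode [Finite V] (K : AbstractSimplicialComplex V) :
    of 𝕜 (K.induce ∅) * HopfAlgebra.antipode 𝕜 (of 𝕜 (K.induce ∅ᶜ)) =
      HopfAlgebra.antipode 𝕜 (of 𝕜 K) := by
  rw [of_induce_of_eq_empty K rfl, one_mul,
    of_eq ((cls_induce_congr K Set.compl_empty).trans (cls_induce_univ K))]

theorem sum_of_mul_orientationSum [Fintype V] [Nonempty V] (K : AbstractSimplicialComplex V) :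
    ∑ U : Set V, of 𝕜 (K.induce U) * orientationSum 𝕜 (K.induce Uᶜ) = 0 := by
  classical
  simp only [of_induce_mul_orientationSum, Finset.sum_filter]
  rw [Finset.sum_comm]
  refine Finset.sum_eq_zero fun D _ => ?_
  rw [← Finset.sum_filter, ← Finset.sum_smul,
    D.sum_neg_one_pow_ncard_image_edgeComponent, zero_smul]

theorem sum_of_mul_antipode [Fintype V] [Nonempty V] (K : AbstractSimplicialComplex V) :
    ∑ U : Set V, of 𝕜 (K.induce U) * HopfAlgebra.antipode 𝕜 (of 𝕜 (K.induce Uᶜ)) = 0 := by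
  have h := HopfAlgebra.mul_antipode_lTensor_comul_apply (R := 𝕜) (of 𝕜 K)
  simpa only [comul_of, counit_of, map_sum, LinearMap.lTensor_tmul, LinearMap.mul'_apply,
    if_neg (not_isEmpty_of_nonempty V), map_zero] using h

theorem antipode_of_eq_orientationSum [Finite V] (K : AbstractSimplicialComplex V) :
    HopfAlgebra.antipode 𝕜 (of 𝕜 K) = orientationSum 𝕜 K := by
  classical
  have := Fintype.ofFinite V
  induction hn : Fintype.card V using Nat.strong_induction_on generalizing V with
  | _ n ih =>
  subst hn
  rcases isEmpty_or_nonempty V with hV | hV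
  · rw [orientationSum_of_isEmpty, of_eq_one, HopfAlgebra.antipode_one]
  · have h : ∑ U : Set V, of 𝕜 (K.induce U) * HopfAlgebra.antipode 𝕜 (of 𝕜 (K.induce Uᶜ)) =
        ∑ U : Set V, of 𝕜 (K.induce U) * orientationSum 𝕜 (K.induce Uᶜ) :=
      (sum_of_mul_antipode K).trans (sum_of_mul_orientationSum K).symm
    rw [← Finset.add_sum_erase _ _ (Finset.mem_univ ∅),
      ← Finset.add_sum_erase _ _ (Finset.mem_univ ∅), of_induce_empty_mul_antipode,
      of_induce_empty_mul_orientationSum] at h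
    refine add_right_cancel (h.trans (congrArg _ (Finset.sum_congr rfl fun U hU => ?_)))
    obtain ⟨x, hx⟩ := Set.nonempty_iff_ne_empty.2 (Finset.ne_of_mem_erase hU)
    rw [ih _ (Fintype.card_subtype_lt (p := (· ∈ Uᶜ)) (not_not_intro hx)) (K.induce Uᶜ) _ rfl]

theorem orientationSum_eq_sum_flats [Finite V] (K : AbstractSimplicialComplex V) :
    orientationSum 𝕜 K =
      ∑ F ∈ K.oneSkeleton.flats,
        ((-1 : 𝕜) ^ numComponents F * ((K.oneSkeleton.contract F).numAcyclicOrientations : 𝕜)) •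
          of 𝕜 (K.restrictEdges F) := by
  rw [orientationSum, PartialOrientation.sum_mutualEdges
    fun F => (-1 : 𝕜) ^ numComponents F • of 𝕜 (K.restrictEdges F)]
  refine Finset.sum_congr rfl fun F _ => ?_
  rw [← Nat.cast_smul_eq_nsmul 𝕜, smul_smul, mul_comm]

end SimplicialHopf

theorem mainTheorem1 (𝕜 : Type v) [Field 𝕜] {V : Type u} [Finite V] [Nonempty V]
    (Γ : AbstractSimplicialComplex V) :
    -- the formula for the antipode
    HopfAlgebra.antipode 𝕜 (SimplicialHopf.of 𝕜 Γ) =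
      ∑ F ∈ Γ.oneSkeleton.flats,
        ((-1 : 𝕜) ^ SimpleGraph.numComponents F *
          ((Γ.oneSkeleton.contract F).numAcyclicOrientations : 𝕜)) •
            SimplicialHopf.of 𝕜 (Γ.restrictEdges F) ∧
    -- it is cancellation-free: the integer coefficients of the terms that belong to the same basis
    -- element are nonzero and of the same sign
    ∀ F ∈ Γ.oneSkeleton.flats, ∀ F' ∈ Γ.oneSkeleton.flats,
      (Γ.restrictEdges F).Isomorphic (Γ.restrictEdges F') →
        0 < ((-1 : ℤ) ^ SimpleGraph.numComponents F *
            ((Γ.oneSkeleton.contract F).numAcyclicOrientations : ℤ)) *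
          ((-1 : ℤ) ^ SimpleGraph.numComponents F' *
            ((Γ.oneSkeleton.contract F').numAcyclicOrientations : ℤ)) := by
  refine ⟨by rw [SimplicialHopf.antipode_of_eq_orientationSum,
    SimplicialHopf.orientationSum_eq_sum_flats], fun F hF F' hF' h => ?_⟩
  have hc : numComponents F = numComponents F' :=
    numComponents_eq_of_isomorphic_restrictEdges (mem_flats.1 hF).1 (mem_flats.1 hF').1 h
  have ha := numAcyclicOrientations_pos (Γ.oneSkeleton.contract F)
  have ha' := numAcyclicOrientations_pos (Γ.oneSkeleton.contract F')
  rw [hc, mul_mul_mul_comm, ← mul_pow, neg_one_mul, neg_neg, one_pow, one_mul]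
  positivity
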